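/- Let $X$ be a complex Banach space and let $T$ be a bounded linear operator on $X$ with spectral radius $r(T)\le 1$ and with no eigenvectors. Let $e\in X$ and put $x_n=T^ne$ for $n=1,2,3,\dots$. Suppose that the sequence $(x_n)_{n\ge1}$ is minimal, i.e. for every $k$ the vector $x_k$ does not lie in the closed linear span of $\{x_i : i\ne k\}$; let $x_k^*$ be the (then well-defined and bounded) biorthogonal functional on $\operatorname{span}\{x_i\}_{i\ge1}$ given by $x_k^*\bigl(\sum_i\alpha_ix_i\bigr)=\alpha_k$, and let $\|x_k^*\|$ be its norm. If $$\sum_{n=1}^\infty\frac{\|x_n^*\|}{n}<\infty,$$ then $T$ has an almost invariant half-space: there is a closed subspace $Y\subseteq X$, of infinite dimension and of infinite codimension in $X$, and a finite-dimensional subspace $F\subseteq X$ such that $T(Y)\subseteq Y+F$. -/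

import Mathlib

noncomputable section

/-- A family `x` of vectors is minimal if no `x k` lies in the closed linear span of the others. -/
def IsMinimalFamily {ι X : Type*} [NormedAddCommGroup X] [NormedSpace ℂ X] (x : ι → X) : Prop :=
  ∀ k, x k ∉ (Submodule.span ℂ (x '' {k}ᶜ)).topologicalClosure

theorem IsMinimalFamily.linearIndependent {ι X : Type*} [NormedAddCommGroup X] [NormedSpace ℂ X]
    {x : ι → X} (hx : IsMinimalFamily x) : LinearIndependent ℂ x := by
  rw [linearIndependent_iff_notMem_span]
  intro k hk
  refine hx k (Submodule.le_topologicalClosure _ ?_)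
  rwa [Set.compl_eq_univ_sdiff]

/-- The algebraic coordinate functional `∑ αᵢ xᵢ ↦ αₖ` on the linear span of a linearly
independent family. -/
def spanCoord {ι X : Type*} [NormedAddCommGroup X] [NormedSpace ℂ X] {x : ι → X}
    (hx : LinearIndependent ℂ x) (k : ι) : Submodule.span ℂ (Set.range x) →ₗ[ℂ] ℂ :=
  Finsupp.lapply k ∘ₗ hx.repr

/-- The coordinate functionals of a minimal family are bounded. -/
theorem IsMinimalFamily.exists_bound {ι X : Type*} [NormedAddCommGroup X] [NormedSpace ℂ X]
    {x : ι → X} (hx : IsMinimalFamily x) (k : ι) :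
    ∃ C : ℝ, ∀ y, ‖spanCoord hx.linearIndependent k y‖ ≤ C * ‖y‖ := by
  classical
  set S : Submodule ℂ X := Submodule.span ℂ (x '' {k}ᶜ) with hS
  set d : ℝ := Metric.infDist (x k) (S : Set X) with hd
  have hne : (S : Set X).Nonempty := ⟨0, S.zero_mem⟩
  have hdpos : 0 < d := by
    have h : x k ∉ closure (S : Set X) := fun h => hx k h
    exact (Metric.infDist_pos_iff_notMem_closure hne).1 h
  refine ⟨d⁻¹, fun y => ?_⟩
  set c : ι →₀ ℂ := hx.linearIndependent.repr y with hc
  have hco : spanCoord hx.linearIndependent k y = c k := rfl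
  rw [hco]
  by_cases h0 : c k = 0
  · rw [h0, norm_zero]; positivity
  have hy : (y : X) = c k • x k + Finsupp.linearCombination ℂ x (c.erase k) := by
    have h1 : Finsupp.linearCombination ℂ x c = y :=
      hx.linearIndependent.linearCombination_repr y
    conv_lhs => rw [← h1, ← Finsupp.single_add_erase k c]
    rw [map_add, Finsupp.linearCombination_single]
  have hz : Finsupp.linearCombination ℂ x (c.erase k) ∈ S := by
    rw [hS, Finsupp.mem_span_image_iff_linearCombination]
    refine ⟨c.erase k, ?_, rfl⟩
    rw [Finsupp.mem_supported]
    intro i hi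
    simp only [Finsupp.support_erase, Finset.coe_erase, Set.mem_sdiff, Set.mem_singleton_iff] at hi
    exact hi.2
  have hle : d ≤ ‖(c k)⁻¹ • (y : X)‖ := by
    have h2 := Metric.infDist_le_dist_of_mem (x := x k)
      (S.neg_mem (S.smul_mem (c k)⁻¹ hz))
    rw [dist_eq_norm, sub_neg_eq_add] at h2
    rwa [hy, smul_add, smul_smul, inv_mul_cancel₀ h0, one_smul]
  rw [norm_smul, norm_inv] at hle
  have hck : 0 < ‖c k‖ := norm_pos_iff.2 h0
  rw [inv_mul_eq_div, le_div_iff₀ hck] at hle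
  rw [inv_mul_eq_div, le_div_iff₀ hdpos, mul_comm]
  exact hle

/-- The biorthogonal functional `xₖ*` of a minimal family, defined on the linear span of the
family by `∑ αᵢ xᵢ ↦ αₖ`, as a bounded functional; `‖xₖ*‖` is its operator norm. -/
def IsMinimalFamily.biorthogonal {ι X : Type*} [NormedAddCommGroup X] [NormedSpace ℂ X]
    {x : ι → X} (hx : IsMinimalFamily x) (k : ι) : Submodule.span ℂ (Set.range x) →L[ℂ] ℂ :=
  (spanCoord hx.linearIndependent k).mkContinuousOfExistsBound (hx.exists_bound k)

theorem IsMinimalFamily.biorthogonal_apply {ι X : Type*} [NormedAddCommGroup X]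
    [NormedSpace ℂ X] [DecidableEq ι] {x : ι → X} (hx : IsMinimalFamily x) (k i : ι) :
    hx.biorthogonal k ⟨x i, Submodule.subset_span ⟨i, rfl⟩⟩ = if i = k then 1 else 0 := by
  change hx.linearIndependent.repr _ k = _
  rw [hx.linearIndependent.repr_eq_single i _ rfl, Finsupp.single_apply]

/-- A half-space: a closed subspace of infinite dimension and infinite codimension. -/
def IsHalfSpace {X : Type*} [NormedAddCommGroup X] [NormedSpace ℂ X] (Y : Submodule ℂ X) : Prop :=
  IsClosed (Y : Set X) ∧ ¬ FiniteDimensional ℂ Y ∧ ¬ FiniteDimensional ℂ (X ⧸ Y)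

/-- `Y` is almost invariant under `T`: `T(Y) ⊆ Y + F` for some finite-dimensional `F`. -/
def IsAlmostInvariant {X : Type*} [NormedAddCommGroup X] [NormedSpace ℂ X]
    (T : X →L[ℂ] X) (Y : Submodule ℂ X) : Prop :=
  ∃ F : Submodule ℂ X, FiniteDimensional ℂ F ∧ ∀ y ∈ Y, T y ∈ Y ⊔ F

end

/-!
Put `v = T e` and `h z = (1 - z T)⁻¹ v = ∑ zⁿ Tⁿ v`. Since `z T (h z) = h z - v`, the closed span
`Y` of any set of vectors `h z`, `z ≠ 0`, satisfies `T Y ⊆ Y + ℂ v`. A functional with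
`f (Tⁿ v) = cₙ` satisfies `f (h z) = ∑ cₙ zⁿ`, and such an `f` exists as soon as
`∑ |cₙ| ‖xₙ₊₁*‖ < ∞`. Suppose `∑ ‖xₙ*‖ / nᵖ < ∞`. The coefficients of
`F z = 2 (1 - z)ᵖ cos (log (1 - z))` are `O(n⁻ᵖ⁻¹)`, hence admissible, and `F` has infinitely many
zeros in the disc. For `Y` spanned by the `h z` at these zeros, the functionals with symbols `zᵏ F`
all vanish on `Y` and give infinite codimension, while those with symbols `zᵏ` show that the `h z`
are linearly independent.
-/

open Filter Topology Asymptotics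
open scoped PowerSeries

section LinearAlgebra

theorem linearIndependent_of_triangular_dual {ι R M : Type*} [LinearOrder ι] [CommRing R]
    [NoZeroDivisors R] [AddCommGroup M] [Module R M] {v : ι → M} {f : ι → Module.Dual R M}
    (hlt : ∀ n k, n < k → f k (v n) = 0) (hdiag : ∀ n, f n (v n) ≠ 0) :
    LinearIndependent R v := by
  rw [linearIndependent_iff]
  intro l hl
  by_contra hne
  have hsupp : l.support.Nonempty := Finsupp.support_nonempty_iff.2 hne
  set N := l.support.max' hsupp
  have hN : N ∈ l.support := l.support.max'_mem hsupp
  have htop : l N * f N (v N) = 0 := by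
    have h := congrArg (f N) hl
    rwa [Finsupp.linearCombination_apply, Finsupp.sum, map_sum, map_zero,
      Finset.sum_eq_single_of_mem N hN, map_smul, smul_eq_mul] at h
    intro n hn hnN
    rw [map_smul, hlt n N (lt_of_le_of_ne (l.support.le_max' n hn) hnN), smul_zero]
  exact mul_ne_zero (Finsupp.mem_support_iff.1 hN) (hdiag N) htop

theorem not_finiteDimensional_quotient_of_triangular_dual {ι K M : Type*} [LinearOrder ι]
    [Infinite ι] [Field K] [AddCommGroup M] [Module K M] {Y : Submodule K M} {v : ι → M}
    {f : ι → Module.Dual K M} (hY : ∀ k, Y ≤ (f k).ker) (hlt : ∀ n k, n < k → f k (v n) = 0)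
    (hdiag : ∀ n, f n (v n) ≠ 0) : ¬ FiniteDimensional K (M ⧸ Y) := by
  intro hfin
  have hli : LinearIndependent K fun n => Y.mkQ (v n) :=
    linearIndependent_of_triangular_dual (f := fun k => Y.liftQ (f k) (hY k)) hlt hdiag
  exact not_finite_iff_infinite.2 inferInstance hli.finite

theorem linearIndependent_geometric {ι K : Type*} [Field K] {z : ι → K}
    (hz : Function.Injective z) : LinearIndependent K fun m (n : ℕ) => z m ^ n :=
  (linearIndependent_monoidHom (Multiplicative ℕ) K).comp (fun m => powersHom K (z m))
    ((powersHom K).injective.comp hz)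

end LinearAlgebra

section BiorthogonalFunctionals

theorem exists_strongDual_apply_eq_of_biorthogonal {ι 𝕜 E : Type*} [DecidableEq ι]
    [NontriviallyNormedField 𝕜] [CompleteSpace 𝕜] [NormedAddCommGroup E] [NormedSpace 𝕜 E]
    {x : ι → E} {φ : ι → E →L[𝕜] 𝕜} (hφ : ∀ k i, φ k (x i) = if i = k then 1 else 0)
    {c : ι → 𝕜} (hc : Summable fun n => ‖c n‖ * ‖φ n‖) :
    ∃ g : E →L[𝕜] 𝕜, ∀ n, g (x n) = c n := by
  have hs : Summable fun n => c n • φ n :=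
    Summable.of_norm (hc.congr fun n => (norm_smul (c n) (φ n)).symm)
  obtain ⟨g, hg⟩ := hs
  refine ⟨g, fun n => ?_⟩
  have hgn := (ContinuousLinearMap.apply 𝕜 𝕜 (x n)).hasSum hg
  refine hgn.unique ((hasSum_ite_eq n (c n)).congr_fun fun k => ?_)
  change c k * φ k (x n) = _
  rw [hφ]
  rcases eq_or_ne k n with rfl | h
  · simp
  · simp [h, h.symm]

theorem IsMinimalFamily.exists_strongDual_apply_eq {ι X : Type*} [NormedAddCommGroup X]
    [NormedSpace ℂ X] {x : ι → X} (hx : IsMinimalFamily x) {c : ι → ℂ}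
    (hc : Summable fun n => ‖c n‖ * ‖hx.biorthogonal n‖) :
    ∃ f : StrongDual ℂ X, ∀ n, f (x n) = c n := by
  classical
  obtain ⟨g, hg⟩ := exists_strongDual_apply_eq_of_biorthogonal hx.biorthogonal_apply hc
  obtain ⟨f, hf, -⟩ := exists_extension_norm_eq (Submodule.span ℂ (Set.range x)) g
  exact ⟨f, fun n => (hf ⟨x n, Submodule.subset_span ⟨n, rfl⟩⟩).trans (hg n)⟩

theorem IsMinimalFamily.exists_strongDual_apply_orbit_eq {X : Type*} [NormedAddCommGroup X]
    [NormedSpace ℂ X] {T : X →L[ℂ] X} {e : X}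
    (hmin : IsMinimalFamily fun n : ℕ+ => (T ^ (n : ℕ)) e) {p : ℕ}
    (hsum : Summable fun n : ℕ+ => ‖hmin.biorthogonal n‖ / (n : ℝ) ^ p) {c : ℕ → ℂ}
    (hc : c =O[atTop] fun n : ℕ => (((n : ℝ) + 1) ^ p)⁻¹) :
    ∃ f : StrongDual ℂ X, ∀ n : ℕ, f ((T ^ n) (T e)) = c n := by
  obtain ⟨C, hC⟩ := (isBigO_nat_atTop_iff fun n h => absurd h (by positivity)).1 hc
  have hcsum : Summable fun n : ℕ+ => ‖c n.natPred‖ * ‖hmin.biorthogonal n‖ := by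
    refine Summable.of_nonneg_of_le (fun n => by positivity) (fun n => ?_) (hsum.mul_left C)
    have hn : ‖c n.natPred‖ ≤ C * ((n : ℝ) ^ p)⁻¹ := by
      have hpred : (n.natPred : ℝ) + 1 = (n : ℝ) := by exact_mod_cast n.natPred_add_one
      simpa [hpred] using hC n.natPred
    calc ‖c n.natPred‖ * ‖hmin.biorthogonal n‖
        ≤ C * ((n : ℝ) ^ p)⁻¹ * ‖hmin.biorthogonal n‖ := by gcongr
      _ = C * (‖hmin.biorthogonal n‖ / (n : ℝ) ^ p) := by ring
  obtain ⟨f, hf⟩ := hmin.exists_strongDual_apply_eq hcsum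
  refine ⟨f, fun n => ?_⟩
  simpa [pow_succ] using hf n.succPNat

end BiorthogonalFunctionals

section OrbitResolvent

theorem hasSum_pow_smul_pow_inverse_one_sub_smul {A : Type*} [NormedRing A] [NormedAlgebra ℂ A]
    [CompleteSpace A] {a : A} {z : ℂ} (hz : ‖z‖₊ < (spectralRadius ℂ a)⁻¹) :
    HasSum (fun n : ℕ => z ^ n • a ^ n) (Ring.inverse (1 - z • a)) := by
  obtain ⟨r, hzr, hr⟩ := ENNReal.lt_iff_exists_nnreal_btwn.1 hz
  have hr0 : 0 < r := zero_le.trans_lt (ENNReal.coe_lt_coe.1 hzr)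
  have hball := (spectrum.hasFPowerSeriesOnBall_inverse_one_sub_smul ℂ a).exchange_radius
    ((spectrum.differentiableOn_inverse_one_sub_smul hr).hasFPowerSeriesOnBall hr0)
  have hmem : z ∈ Metric.eball (0 : ℂ) r := by
    rwa [Metric.mem_eball, edist_zero_right]
  simpa using hball.hasSum hmem

variable {X : Type*} [NormedAddCommGroup X] [NormedSpace ℂ X]

/-- The vector `(1 - z T)⁻¹ v`, which is the generating function `∑ zⁿ Tⁿ v` of the orbit of `v`
for small `z`; it has the junk value `0` when `1 - z T` is not invertible. -/
noncomputable def orbitResolvent (T : X →L[ℂ] X) (v : X) (z : ℂ) : X :=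
  Ring.inverse (1 - z • T) v

/-- The closed linear span of the vectors `(1 - zᵢ T)⁻¹ v`, the candidate for an almost invariant
half-space. -/
def orbitResolventSpan {ι : Type*} (T : X →L[ℂ] X) (v : X) (z : ι → ℂ) : Submodule ℂ X :=
  (Submodule.span ℂ (Set.range fun i => orbitResolvent T v (z i))).topologicalClosure

variable {T : X →L[ℂ] X} {v : X}

theorem orbitResolvent_sub_smul_apply {z : ℂ} (hz : IsUnit (1 - z • T)) :
    orbitResolvent T v z - z • T (orbitResolvent T v z) = v := by
  simpa [orbitResolvent] using congrArg (fun S : X →L[ℂ] X => S v) (Ring.mul_inverse_cancel _ hz)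

theorem hasSum_apply_orbitResolvent [CompleteSpace X] {z : ℂ}
    (hz : ‖z‖₊ < (spectralRadius ℂ T)⁻¹) (f : StrongDual ℂ X) :
    HasSum (fun n : ℕ => f ((T ^ n) v) * z ^ n) (f (orbitResolvent T v z)) := by
  have h := ((hasSum_pow_smul_pow_inverse_one_sub_smul hz).mapL
    (ContinuousLinearMap.apply ℂ X v)).mapL f
  simpa [orbitResolvent, mul_comm] using h

variable {ι : Type*} {z : ι → ℂ}

theorem orbitResolvent_mem_orbitResolventSpan (i : ι) :
    orbitResolvent T v (z i) ∈ orbitResolventSpan T v z :=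
  Submodule.le_topologicalClosure _ (Submodule.subset_span ⟨i, rfl⟩)

theorem orbitResolventSpan_le {S : Submodule ℂ X} (hS : IsClosed (S : Set X))
    (h : ∀ i, orbitResolvent T v (z i) ∈ S) : orbitResolventSpan T v z ≤ S :=
  Submodule.topologicalClosure_minimal _ (Submodule.span_le.2 (Set.range_subset_iff.2 h)) hS

theorem isAlmostInvariant_orbitResolventSpan (hz : ∀ i, z i ≠ 0)
    (hunit : ∀ i, IsUnit (1 - z i • T)) : IsAlmostInvariant T (orbitResolventSpan T v z) := by
  set Y := orbitResolventSpan T v z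
  refine ⟨Submodule.span ℂ {v}, inferInstance, ?_⟩
  have hclosed : IsClosed ((Y ⊔ Submodule.span ℂ {v} : Submodule ℂ X) : Set X) :=
    Submodule.isClosed_sup_finiteDimensional _ _ (Submodule.isClosed_topologicalClosure _)
  suffices Y ≤ (Y ⊔ Submodule.span ℂ {v}).comap (T : X →ₗ[ℂ] X) from fun y hy => this hy
  refine orbitResolventSpan_le (hclosed.preimage T.continuous) fun i => ?_
  have hT : T (orbitResolvent T v (z i)) = (z i)⁻¹ • (orbitResolvent T v (z i) - v) := by
    rw [eq_inv_smul_iff₀ (hz i), eq_sub_iff_add_eq, ← eq_sub_iff_add_eq']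
    exact (orbitResolvent_sub_smul_apply (hunit i)).symm
  rw [Submodule.mem_comap, ContinuousLinearMap.coe_coe, hT]
  exact Submodule.smul_mem _ _ (Submodule.sub_mem _
    (Submodule.mem_sup_left (orbitResolvent_mem_orbitResolventSpan i))
    (Submodule.mem_sup_right (Submodule.mem_span_singleton_self v)))

end OrbitResolvent

section Symbols

theorem hasSum_coeff_X_pow_mul {D : ℂ⟦X⟧} {z s : ℂ}
    (hD : HasSum (fun n => D.coeff n * z ^ n) s) (k : ℕ) :
    HasSum (fun n => (PowerSeries.X ^ k * D).coeff n * z ^ n) (z ^ k * s) := by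
  rw [← hasSum_nat_add_iff' k, Finset.sum_eq_zero, sub_zero]
  · refine (hD.mul_left (z ^ k)).congr_fun fun n => ?_
    rw [PowerSeries.coeff_X_pow_mul]
    ring
  · intro n hn
    rw [PowerSeries.coeff_X_pow_mul', if_neg (Finset.mem_range.1 hn).not_ge, zero_mul]

theorem isBigO_coeff_X_pow_mul {D : ℂ⟦X⟧} {p : ℕ}
    (hD : (D.coeff ·) =O[atTop] fun n : ℕ => (((n : ℝ) + 1) ^ p)⁻¹) (k : ℕ) :
    ((PowerSeries.X ^ k * D).coeff ·) =O[atTop] fun n : ℕ => (((n : ℝ) + 1) ^ p)⁻¹ := by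
  suffices (fun n => (PowerSeries.X ^ k * D).coeff (n + k)) =O[atTop]
      fun n : ℕ => ((((n + k : ℕ) : ℝ) + 1) ^ p)⁻¹ by
    rw [← map_add_atTop_eq_nat k]
    exact isBigO_map.2 this
  simp only [PowerSeries.coeff_X_pow_mul]
  refine hD.trans (IsBigO.of_bound (((k : ℝ) + 1) ^ p) (.of_forall fun n => ?_))
  have hle : ((n + k : ℕ) : ℝ) + 1 ≤ ((k : ℝ) + 1) * (n + 1) := by
    push_cast
    nlinarith [mul_nonneg (Nat.cast_nonneg (α := ℝ) k) (Nat.cast_nonneg (α := ℝ) n)]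
  rw [Real.norm_of_nonneg (by positivity), Real.norm_of_nonneg (by positivity), ← div_eq_mul_inv,
    inv_le_comm₀ (by positivity) (by positivity), inv_div, div_le_iff₀' (by positivity), ← mul_pow]
  gcongr

end Symbols

section InfiniteDimension

variable {X : Type*} [NormedAddCommGroup X] [NormedSpace ℂ X] [CompleteSpace X]
  {T : X →L[ℂ] X} {v : X}

theorem apply_orbitResolvent_eq {D : ℂ⟦X⟧} {k : ℕ} {f : StrongDual ℂ X}
    (hf : ∀ n, f ((T ^ n) v) = (PowerSeries.X ^ k * D).coeff n) {z s : ℂ}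
    (hz : ‖z‖₊ < (spectralRadius ℂ T)⁻¹) (hD : HasSum (fun n => D.coeff n * z ^ n) s) :
    f (orbitResolvent T v z) = z ^ k * s :=
  (hasSum_apply_orbitResolvent hz f).unique
    ((hasSum_coeff_X_pow_mul hD k).congr_fun fun n => by rw [hf])

variable {ι : Type*} {z : ι → ℂ}

theorem not_finiteDimensional_orbitResolventSpan [Infinite ι] (hinj : Function.Injective z)
    (hz : ∀ i, ‖z i‖₊ < (spectralRadius ℂ T)⁻¹)
    (hf : ∀ k : ℕ, ∃ f : StrongDual ℂ X, ∀ n,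
      f ((T ^ n) v) = (PowerSeries.X ^ k : ℂ⟦X⟧).coeff n) :
    ¬ FiniteDimensional ℂ (orbitResolventSpan T v z) := by
  choose f hf using hf
  have hone (i : ι) : HasSum (fun n => (1 : ℂ⟦X⟧).coeff n * z i ^ n) 1 := by
    refine (hasSum_ite_eq 0 1).congr_fun fun n => ?_
    rcases eq_or_ne n 0 with rfl | hn
    · simp
    · simp [PowerSeries.coeff_one, hn]
  have hgeom : ((LinearMap.pi fun k => (f k : X →ₗ[ℂ] ℂ)) ∘ₗ (orbitResolventSpan T v z).subtype) ∘
      (fun i => ⟨orbitResolvent T v (z i), orbitResolvent_mem_orbitResolventSpan i⟩) =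
        fun i (k : ℕ) => z i ^ k := by
    ext i k
    simpa using apply_orbitResolvent_eq (D := 1) (by simpa using hf k) (hz i) (hone i)
  have hli := LinearIndependent.of_comp _ (hgeom ▸ linearIndependent_geometric hinj)
  intro hfin
  exact not_finite_iff_infinite.2 inferInstance hli.finite

theorem not_finiteDimensional_quotient_orbitResolventSpan
    (hz : ∀ i, ‖z i‖₊ < (spectralRadius ℂ T)⁻¹) {D : ℂ⟦X⟧} (hD0 : D.coeff 0 ≠ 0)
    (hD : ∀ i, HasSum (fun n => D.coeff n * z i ^ n) 0)
    (hf : ∀ k : ℕ, ∃ f : StrongDual ℂ X, ∀ n,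
      f ((T ^ n) v) = (PowerSeries.X ^ k * D).coeff n) :
    ¬ FiniteDimensional ℂ (X ⧸ orbitResolventSpan T v z) := by
  choose f hf using hf
  refine not_finiteDimensional_quotient_of_triangular_dual (v := fun n => (T ^ n) v)
    (f := fun k => (f k : X →ₗ[ℂ] ℂ)) (fun k => ?_) (fun n k hnk => ?_) fun n => ?_
  · refine orbitResolventSpan_le (f k).isClosed_ker fun i => ?_
    simpa using apply_orbitResolvent_eq (hf k) (hz i) (hD i)
  · rw [ContinuousLinearMap.coe_coe, hf, PowerSeries.coeff_X_pow_mul', if_neg hnk.not_ge]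
  · rw [ContinuousLinearMap.coe_coe, hf, PowerSeries.coeff_X_pow_mul', if_pos le_rfl, tsub_self]
    exact hD0

end InfiniteDimension

section OscillatingSeries

open Complex in
theorem multichoose_eq_cpow_div_gammaSeq {b : ℂ} (hb : ∀ m : ℕ, b ≠ -m) {n : ℕ} (hn : n ≠ 0) :
    Ring.multichoose b n = (n : ℂ) ^ b / ((b + n) * GammaSeq b n) := by
  have hadd (m : ℕ) : b + m ≠ 0 := fun h => hb m (eq_neg_of_add_eq_zero_left h)
  have hprod : n.factorial * Ring.multichoose b n = ∏ j ∈ Finset.range n, (b + j) := by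
    rw [← nsmul_eq_mul, Ring.factorial_nsmul_multichoose_eq_ascPochhammer,
      Polynomial.ascPochhammer_smeval_eq_eval]
    clear hn
    induction n with
    | zero => simp
    | succ n ih => rw [ascPochhammer_succ_eval, ih, Finset.prod_range_succ]
  have hprod0 : ∏ j ∈ Finset.range n, (b + j) ≠ 0 := Finset.prod_ne_zero_iff.2 fun j _ => hadd j
  have hfact : (n.factorial : ℂ) ≠ 0 := by exact_mod_cast n.factorial_ne_zero
  have hpow : (n : ℂ) ^ b ≠ 0 := (cpow_ne_zero_iff_of_exponent_ne_zero (by simpa using hb 0)).2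
    (Nat.cast_ne_zero.2 hn)
  have hlast := hadd n
  rw [GammaSeq, Finset.prod_range_succ, ← hprod]
  rw [← hprod] at hprod0
  have hmulti := right_ne_zero_of_mul hprod0
  field_simp

open Complex in
theorem tendsto_multichoose_mul_cpow {b : ℂ} (hb : ∀ m : ℕ, b ≠ -m) :
    Tendsto (fun n : ℕ => Ring.multichoose b n * (n : ℂ) ^ (1 - b)) atTop (𝓝 (Gamma b)⁻¹) := by
  have hlim : Tendsto (fun n : ℕ => (n / (n + b)) * (GammaSeq b n)⁻¹) atTop (𝓝 (Gamma b)⁻¹) := by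
    simpa using (tendsto_natCast_div_add_atTop b).mul
      ((GammaSeq_tendsto_Gamma b).inv₀ (Gamma_ne_zero hb))
  refine hlim.congr' ?_
  filter_upwards [eventually_ne_atTop 0] with n hn
  have hn0 : (n : ℂ) ≠ 0 := Nat.cast_ne_zero.2 hn
  have hpow : (n : ℂ) = (n : ℂ) ^ b * (n : ℂ) ^ (1 - b) := by
    rw [← cpow_add _ _ hn0, add_sub_cancel, cpow_one]
  calc (n / (n + b)) * (GammaSeq b n)⁻¹
      = (n : ℂ) ^ b * (n : ℂ) ^ (1 - b) / (n + b) * (GammaSeq b n)⁻¹ := by rw [← hpow]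
    _ = (n : ℂ) ^ b / ((b + n) * GammaSeq b n) * (n : ℂ) ^ (1 - b) := by
      rw [add_comm b, div_mul_eq_div_div]
      ring
    _ = Ring.multichoose b n * (n : ℂ) ^ (1 - b) := by
      rw [multichoose_eq_cpow_div_gammaSeq hb hn]

theorem isBigO_multichoose {b : ℂ} (hb : ∀ m : ℕ, b ≠ -m) :
    Ring.multichoose b =O[atTop] fun n : ℕ => (n : ℝ) ^ (b.re - 1) := by
  have h := ((tendsto_multichoose_mul_cpow hb).isBigO_one ℝ).mul
    (isBigO_refl (fun n : ℕ => (n : ℂ) ^ (b - 1)) atTop).norm_right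
  refine (h.congr' ?_ .rfl).trans ?_
  · filter_upwards [eventually_ne_atTop 0] with n hn
    rw [mul_assoc, ← Complex.cpow_add _ _ (Nat.cast_ne_zero.2 hn), sub_add_sub_cancel', sub_self,
      Complex.cpow_zero, mul_one]
  · refine IsBigO.of_bound 1 ?_
    filter_upwards [eventually_gt_atTop 0] with n hn
    simp [Complex.norm_natCast_cpow_of_pos hn, Real.abs_rpow_of_nonneg]

theorem hasSum_multichoose_mul_pow (b : ℂ) {z : ℂ} (hz : ‖z‖ < 1) :
    HasSum (fun n => Ring.multichoose b n * z ^ n) (1 / (1 - z) ^ b) := by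
  have hmem : z ∈ Metric.eball (0 : ℂ) 1 := by
    rw [Metric.mem_eball, edist_zero_right, ← ofReal_norm]
    exact ENNReal.ofReal_lt_one.2 hz
  simpa [Ring.multichoose_eq, mul_comm] using
    (Complex.one_div_one_sub_cpow_hasFPowerSeriesOnBall_zero b).hasSum hmem

/-- The Taylor series at `0` of `(1 - z) ^ (p - i) + (1 - z) ^ (p + i)`, which equals
`2 (1 - z) ^ p cos (log (1 - z))`: it has infinitely many zeros in the unit disc although its
coefficients decay polynomially. -/
noncomputable def oscillatingSeries (p : ℕ) : ℂ⟦X⟧ :=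
  PowerSeries.mk fun n =>
    Ring.multichoose (-p + Complex.I) n + Ring.multichoose (-p - Complex.I) n

/-- The zeros of `oscillatingSeries p` in the interval `(0, 1)`, at which `log (1 - z)` is an odd
multiple of `π / 2`. -/
noncomputable def oscillatingZero (m : ℕ) : ℂ :=
  1 - Real.exp (-(Real.pi * (m + 1 / 2)))

theorem coeff_zero_oscillatingSeries_ne_zero (p : ℕ) : (oscillatingSeries p).coeff 0 ≠ 0 := by
  norm_num [oscillatingSeries]

theorem isBigO_coeff_oscillatingSeries (p : ℕ) :
    ((oscillatingSeries p).coeff ·) =O[atTop] fun n : ℕ => (((n : ℝ) + 1) ^ p)⁻¹ := by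
  have hplus : Ring.multichoose (-p + Complex.I) =O[atTop] fun n : ℕ => (n : ℝ) ^ (-p - 1 : ℝ) := by
    simpa using isBigO_multichoose (b := -p + Complex.I) fun m h => by
      simpa using congrArg Complex.im h
  have hminus : Ring.multichoose (-p - Complex.I) =O[atTop]
      fun n : ℕ => (n : ℝ) ^ (-p - 1 : ℝ) := by
    simpa using isBigO_multichoose (b := -p - Complex.I) fun m h => by
      simpa using congrArg Complex.im h
  simp only [oscillatingSeries, PowerSeries.coeff_mk]
  refine (hplus.add hminus).trans (IsBigO.of_bound (2 ^ p) ?_)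
  filter_upwards [eventually_ge_atTop 1] with n hn
  have hn1 : (1 : ℝ) ≤ n := by exact_mod_cast hn
  have hle : ((n : ℝ) + 1) ^ p ≤ 2 ^ p * (n : ℝ) ^ (p + 1) :=
    calc ((n : ℝ) + 1) ^ p ≤ (2 * n) ^ p := by gcongr; linarith
      _ = 2 ^ p * (n : ℝ) ^ p := mul_pow _ _ _
      _ ≤ 2 ^ p * (n : ℝ) ^ (p + 1) := by gcongr; exact p.le_succ
  have hrpow : (n : ℝ) ^ (-p - 1 : ℝ) = ((n : ℝ) ^ (p + 1))⁻¹ := by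
    rw [← Real.rpow_natCast, ← Real.rpow_neg n.cast_nonneg]
    push_cast
    ring_nf
  rw [hrpow, Real.norm_of_nonneg (by positivity), Real.norm_of_nonneg (by positivity),
    ← div_eq_mul_inv, inv_le_comm₀ (by positivity) (by positivity), inv_div,
    div_le_iff₀' (by positivity)]
  exact hle

open Complex in
theorem one_div_exp_cpow_add_one_div_exp_cpow (s : ℂ) (t : ℝ) :
    1 / (Real.exp t : ℂ) ^ (-s + I) + 1 / (Real.exp t : ℂ) ^ (-s - I)
      = 2 * exp (s * t) * cos t := by
  have hpow (b : ℂ) : 1 / (Real.exp t : ℂ) ^ b = exp (-(t * b)) := by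
    rw [cpow_def_of_ne_zero (by exact_mod_cast (Real.exp_pos t).ne'),
      ← ofReal_log (Real.exp_pos t).le, Real.log_exp, one_div, exp_neg]
  rw [hpow, hpow, cos, mul_right_comm, mul_div_cancel₀ _ two_ne_zero, add_mul, ← exp_add,
    ← exp_add, add_comm]
  ring_nf

theorem hasSum_coeff_oscillatingSeries_mul_pow (p : ℕ) {z : ℂ} (hz : ‖z‖ < 1) :
    HasSum (fun n => (oscillatingSeries p).coeff n * z ^ n)
      (1 / (1 - z) ^ (-p + Complex.I) + 1 / (1 - z) ^ (-p - Complex.I)) := by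
  simpa [oscillatingSeries, add_mul] using
    (hasSum_multichoose_mul_pow (-p + Complex.I) hz).add
      (hasSum_multichoose_mul_pow (-p - Complex.I) hz)

theorem norm_oscillatingZero_lt_one (m : ℕ) : ‖oscillatingZero m‖ < 1 := by
  have hpos := Real.exp_pos (-(Real.pi * (m + 1 / 2)))
  have hle : Real.exp (-(Real.pi * (m + 1 / 2))) ≤ 1 :=
    Real.exp_le_one_iff.2 (neg_nonpos.2 (by positivity))
  rw [oscillatingZero, ← Complex.ofReal_one, ← Complex.ofReal_sub, Complex.norm_real,
    Real.norm_eq_abs, abs_lt]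
  constructor <;> linarith

theorem oscillatingZero_ne_zero (m : ℕ) : oscillatingZero m ≠ 0 := by
  have hlt : Real.exp (-(Real.pi * (m + 1 / 2))) < 1 :=
    Real.exp_lt_one_iff.2 (neg_neg_of_pos (by positivity))
  rw [oscillatingZero, sub_ne_zero]
  exact_mod_cast hlt.ne'

theorem oscillatingZero_injective : Function.Injective oscillatingZero := by
  intro m k h
  have hexp : Real.exp (-(Real.pi * (m + 1 / 2))) = Real.exp (-(Real.pi * (k + 1 / 2))) := by
    exact_mod_cast sub_right_injective h
  simpa [Real.pi_ne_zero] using hexp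

theorem hasSum_coeff_oscillatingSeries_mul_oscillatingZero_pow (p m : ℕ) :
    HasSum (fun n => (oscillatingSeries p).coeff n * oscillatingZero m ^ n) 0 := by
  have hcos : Real.cos (-(Real.pi * (m + 1 / 2))) = 0 := by
    rw [Real.cos_neg, Real.cos_eq_zero_iff]
    exact ⟨m, by push_cast; ring⟩
  have h := hasSum_coeff_oscillatingSeries_mul_pow p (norm_oscillatingZero_lt_one m)
  rwa [show 1 - oscillatingZero m = Real.exp (-(Real.pi * (m + 1 / 2))) from sub_sub_cancel _ _,
    one_div_exp_cpow_add_one_div_exp_cpow, ← Complex.ofReal_cos, hcos, Complex.ofReal_zero,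
    mul_zero] at h

end OscillatingSeries

theorem theorem4p1_general {X : Type*} [NormedAddCommGroup X] [NormedSpace ℂ X] [CompleteSpace X]
    (T : X →L[ℂ] X) (hr : spectralRadius ℂ T ≤ 1) (e : X)
    (hmin : IsMinimalFamily (fun n : ℕ+ => (T ^ (n : ℕ)) e)) (p : ℕ)
    (hsum : Summable fun n : ℕ+ => ‖hmin.biorthogonal n‖ / (n : ℝ) ^ p) :
    ∃ Y : Submodule ℂ X, IsHalfSpace Y ∧ IsAlmostInvariant T Y := by
  have hz (m : ℕ) : ‖oscillatingZero m‖₊ < (spectralRadius ℂ T)⁻¹ :=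
    lt_of_lt_of_le (by exact_mod_cast norm_oscillatingZero_lt_one m) (ENNReal.one_le_inv.2 hr)
  have hone : ((1 : ℂ⟦X⟧).coeff ·) =O[atTop] fun n : ℕ => (((n : ℝ) + 1) ^ p)⁻¹ := by
    refine IsBigO.of_bound 0 ?_
    filter_upwards [eventually_ne_atTop 0] with n hn
    simp [PowerSeries.coeff_one, hn]
  have hdual {D : ℂ⟦X⟧} (hD : (D.coeff ·) =O[atTop] fun n : ℕ => (((n : ℝ) + 1) ^ p)⁻¹) (k : ℕ) :
      ∃ f : StrongDual ℂ X, ∀ n, f ((T ^ n) (T e)) = (PowerSeries.X ^ k * D).coeff n :=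
    hmin.exists_strongDual_apply_orbit_eq hsum (isBigO_coeff_X_pow_mul hD k)
  refine ⟨orbitResolventSpan T (T e) oscillatingZero,
    ⟨Submodule.isClosed_topologicalClosure _, ?_, ?_⟩, ?_⟩
  · exact not_finiteDimensional_orbitResolventSpan oscillatingZero_injective hz
      (by simpa using hdual hone)
  · exact not_finiteDimensional_quotient_orbitResolventSpan hz
      (coeff_zero_oscillatingSeries_ne_zero p)
      (hasSum_coeff_oscillatingSeries_mul_oscillatingZero_pow p)
      (hdual (isBigO_coeff_oscillatingSeries p))
  · exact isAlmostInvariant_orbitResolventSpan oscillatingZero_ne_zero fun m =>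
      spectrum.isUnit_one_sub_smul_of_lt_inv_radius (hz m)

theorem theorem4p1 {X : Type*} [NormedAddCommGroup X] [NormedSpace ℂ X] [CompleteSpace X]
    (T : X →L[ℂ] X) (hr : spectralRadius ℂ T ≤ 1)
    (hT : ∀ (μ : ℂ) (v : X), ¬ Module.End.HasEigenvector (T : X →ₗ[ℂ] X) μ v)
    (e : X) (hmin : IsMinimalFamily (fun n : ℕ+ => (T ^ (n : ℕ)) e))
    (hsum : Summable fun n : ℕ+ => ‖hmin.biorthogonal n‖ / (n : ℝ)) :
    ∃ Y : Submodule ℂ X, IsHalfSpace Y ∧ IsAlmostInvariant T Y := by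
  exact theorem4p1_general T hr e hmin 1 (by simpa using hsum)
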